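/- **Setting.** Let $d,n,m$ be natural numbers with $n\ge 1$, and let $x_1,\dots,x_n\in\mathbb R^d$ be unit vectors, $\|x_i\|_2=1$, no two of them parallel: there is $\theta_0>0$ with $\min\{\theta_{ij},\pi-\theta_{ij}\}\ge\theta_0$ for all $i\ne j$, where $\theta_{ij}=\arccos\langle x_i,x_j\rangle$. Put $X=(x_1,\dots,x_n)\in\mathbb R^{d\times n}$. Let $W(0)=(w_1,\dots,w_m)\in\mathbb R^{d\times m}$ have independent columns $w_r\sim\mathcal N(0,I_d)$. Let $\phi'(z)=1$ for $z\ge 0$ and $\phi'(z)=0$ for $z<0$, and let $\Psi=\phi'(X^\top W(0))\in\{0,1\}^{n\times m}$ (entrywise) be the initial activation matrix, with rows $\widetilde\psi_1,\dots,\widetilde\psi_n$. Let $$\mho=\mathbb E_{w\sim\mathcal N(0,I_d)}\big[\phi'(X^\top w)\,\phi'(w^\top X)\big]\in\mathbb R^{n\times n},\qquad \lambda^*=\lambda_{\min}(\mho),$$ and, for $n\ge2$, let $\theta^*=\min\{\min_{i\ne j}\theta_{ij},\ \pi-\max_{i\ne j}\theta_{ij}\}$. **Claim.** There is a universal constant $C>0$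 such that, for all data as above: 1. $\mho_{ij}=\dfrac{\pi-\theta_{ij}}{2\pi}$ for all $i,j$, and $\ \tfrac14\lambda_{\min}(X^\top X)\le\lambda^*\le\tfrac12$. Moreover, for every $\delta\in(0,1)$ (all probabilities are over $W(0)$): 2. for each $i$, with probability exceeding $1-\delta$, $\ \|\widetilde\psi_i\|_2^2\le \frac m2+\sqrt{\frac m2\log\frac1\delta}$; and for each $i$, with probability exceeding $1-\delta$, $\ \|\widetilde\psi_i\|_2^2\ge \frac m2-\sqrt{\frac m2\log\frac1\delta}$; 3. with probability exceeding $1-n\delta$, $\ \|\Psi\|_F^2\le\frac{mn}2+n\sqrt{\frac m2\log\frac1\delta}$; and with probability exceeding $1-n\delta$, $\ \|\Psi\|_F^2\ge\frac{mn}2-n\sqrt{\frac m2\log\frac1\delta}$; 4. for each pair $i\ne j$, with probability exceeding $1-2\delta$, $\ \langle\widetilde\psi_i,\widetilde\psi_j\rangle\le\frac m2+\sqrt{\frac m2\log\frac1\delta}$; 5. if $2\le n\le m$, then with probability exceeding $1-(mn-m+n+2)\delta$, $$\sigma_{\min}^2(\Psi)>\lambda^*m-n\sqrt{\Big[2-\frac{\theta^*(\theta^*+3\pi)}{2\pi^2}\Big]m\log\frac{2n}{\delta}}-C\Big(\sqrt{m\log\tfrac1\delta}+\frac{n\log(2n/\delta)}{\sqrt\delta}\Big).$$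 -/

import Mathlib

open MeasureTheory ProbabilityTheory InnerProductGeometry Real

namespace ReLUInit

noncomputable section

/-- The derivative of the ReLU function `z ↦ max z 0`, with the value `1` at the kink. -/
def reluDeriv (z : ℝ) : ℝ := if 0 ≤ z then 1 else 0

/-- The data matrix `X = (x₁, …, xₙ)`, of size `d × n`, whose columns are the input vectors. -/
def dataMatrix {d n : ℕ} (x : Fin n → EuclideanSpace ℝ (Fin d)) : Matrix (Fin d) (Fin n) ℝ :=
  Matrix.of fun k i => x i k

/-- The weight matrix `W = (w₁, …, wₘ)`, of size `d × m`, whose columns are the weight vectors. -/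
def weightMatrix {d m : ℕ} (w : Fin m → EuclideanSpace ℝ (Fin d)) : Matrix (Fin d) (Fin m) ℝ :=
  Matrix.of fun k r => w r k

/-- The activation matrix `Ψ = φ'(Xᵀ W)`, of size `n × m`, where `φ'` is applied entrywise. -/
def activationMatrix {d n m : ℕ} (x : Fin n → EuclideanSpace ℝ (Fin d))
    (w : Fin m → EuclideanSpace ℝ (Fin d)) : Matrix (Fin n) (Fin m) ℝ :=
  ((dataMatrix x).transpose * weightMatrix w).map reluDeriv

/-- The law of the random initialization: the `m` weight vectors are independent, each with the
standard Gaussian distribution `N(0, I_d)`. -/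
def initMeasure (d m : ℕ) : Measure (Fin m → EuclideanSpace ℝ (Fin d)) :=
  Measure.pi fun _ => stdGaussian (EuclideanSpace ℝ (Fin d))

/-- The matrix `℧ = 𝔼 [φ'(Xᵀ w) φ'(wᵀ X)]` for `w ~ N(0, I_d)`. -/
def mho {d n : ℕ} (x : Fin n → EuclideanSpace ℝ (Fin d)) : Matrix (Fin n) (Fin n) ℝ :=
  Matrix.of fun i j =>
    ∫ w, reluDeriv (inner ℝ (x i) w) * reluDeriv (inner ℝ (x j) w)
      ∂(stdGaussian (EuclideanSpace ℝ (Fin d)))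

/-- The smallest eigenvalue of a (symmetric) real matrix. -/
def lambdaMin {n : ℕ} (A : Matrix (Fin n) (Fin n) ℝ) : ℝ := sInf (spectrum ℝ A)

/-- The smallest of the `min n m` singular values of an `n × m` matrix (Mathlib lists singular
values in decreasing order, starting from index `0`). -/
def sigmaMin {n m : ℕ} (A : Matrix (Fin n) (Fin m) ℝ) : ℝ :=
  (Matrix.toEuclideanLin A).singularValues (min n m - 1)

/-- The `i`-th row of a matrix as a Euclidean vector. -/
def row {n m : ℕ} (A : Matrix (Fin n) (Fin m) ℝ) (i : Fin n) : EuclideanSpace ℝ (Fin m) :=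
  WithLp.toLp 2 (A i)

section Frobenius

attribute [local instance] Matrix.frobeniusNormedAddCommGroup

/-- The Frobenius norm of a matrix. -/
def frobNorm {n m : ℕ} (A : Matrix (Fin n) (Fin m) ℝ) : ℝ := ‖A‖

end Frobenius

/-- `θ_min`, the smallest angle between two distinct input vectors (meaningful for `2 ≤ n`). -/
def thetaMin {d n : ℕ} (x : Fin n → EuclideanSpace ℝ (Fin d)) : ℝ :=
  ⨅ p : {p : Fin n × Fin n // p.1 ≠ p.2}, angle (x p.1.1) (x p.1.2)

/-- `θ_max`, the largest angle between two distinct input vectors (meaningful for `2 ≤ n`). -/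
def thetaMax {d n : ℕ} (x : Fin n → EuclideanSpace ℝ (Fin d)) : ℝ :=
  ⨆ p : {p : Fin n × Fin n // p.1 ≠ p.2}, angle (x p.1.1) (x p.1.2)

/-- `θ* = min {θ_min, π - θ_max}`. -/
def thetaStar {d n : ℕ} (x : Fin n → EuclideanSpace ℝ (Fin d)) : ℝ :=
  min (thetaMin x) (π - thetaMax x)

end

end ReLUInit

open ReLUInit

/-! ### Extreme eigenvalues, singular values and Hadamard powers -/

section MatrixBounds

open Matrix

/-! Each entry of `Ψ Ψᵀ` counts the weights lying in an intersection of two half-spaces, and the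
Gaussian measure of that intersection is the corresponding entry of `℧`. Projecting to the plane of
two inputs turns the intersection into a wedge, so its measure is an angle over `2π`
(`stdGaussian_orthant`).

Hence `℧ = J / 4 + arcsin(G) / (2π)` entrywise, with `J` all ones and `G` the Gram matrix. The odd
power series of arcsin has nonnegative coefficients, and the Schur product theorem bounds every odd
Hadamard power of `G` below by `λ_min(G)`; this is the lower bound on `λ*` (`le_quadForm_arcsin`).

The probabilistic claims are Hoeffding bounds for counts (`measureReal_pi_count_gt_lt`) and union
bounds. For `σ_min`, all entries of `Ψ Ψᵀ` are within `t = √(m/2 · log(2n/δ))` of `m ℧`, which moves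
the quadratic form by at most `n t` (`le_sigmaMin_sq_of_gram_close`). Since `θ* ≤ π/2`, the stated
coefficient under the root exceeds `1/2`, so the stated error dominates `n t`. -/

theorem posSemidef_sub_lambdaMin {n : ℕ} {A : Matrix (Fin n) (Fin n) ℝ} (hA : A.IsHermitian) :
    (A - lambdaMin A • 1).PosSemidef := by
  rw [← Algebra.algebraMap_eq_smul_one, Matrix.posSemidef_iff_isHermitian_and_spectrum_nonneg]
  refine ⟨hA.sub ?_, ?_⟩
  · rw [Matrix.algebraMap_eq_diagonal]
    exact Matrix.isHermitian_diagonal _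
  · rw [← spectrum.sub_singleton_eq]
    rintro _ ⟨y, hy, _, rfl, rfl⟩
    have : lambdaMin A ≤ y := csInf_le A.finite_real_spectrum.bddBelow hy
    simpa using this

theorem lambdaMin_mul_le {n : ℕ} {A : Matrix (Fin n) (Fin n) ℝ} (hA : A.IsHermitian)
    (a : Fin n → ℝ) : lambdaMin A * (a ⬝ᵥ a) ≤ a ⬝ᵥ A *ᵥ a := by
  have h := (posSemidef_sub_lambdaMin hA).dotProduct_mulVec_nonneg a
  rw [Matrix.sub_mulVec, dotProduct_sub, Matrix.smul_mulVec, Matrix.one_mulVec, dotProduct_smul,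
    star_trivial, smul_eq_mul] at h
  linarith

theorem le_lambdaMin {n : ℕ} (hn : 0 < n) {A : Matrix (Fin n) (Fin n) ℝ} (hA : A.IsHermitian)
    {c : ℝ} (h : ∀ a : Fin n → ℝ, c * (a ⬝ᵥ a) ≤ a ⬝ᵥ A *ᵥ a) : c ≤ lambdaMin A := by
  refine le_csInf ⟨_, hA.eigenvalues_mem_spectrum_real ⟨0, hn⟩⟩ fun μ hμ => ?_
  rw [hA.spectrum_real_eq_range_eigenvalues] at hμ
  obtain ⟨i, rfl⟩ := hμ
  have hv : (0 : ℝ) < (⇑(hA.eigenvectorBasis i) : Fin n → ℝ) ⬝ᵥ ⇑(hA.eigenvectorBasis i) := by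
    have := (dotProduct_self_star_pos_iff (v := (⇑(hA.eigenvectorBasis i) : Fin n → ℝ))).2 ?_
    · simpa using this
    · intro h0
      apply hA.eigenvectorBasis.toBasis.ne_zero i
      ext k
      simpa using congrFun h0 k
  have h1 := h (⇑(hA.eigenvectorBasis i))
  rw [hA.mulVec_eigenvectorBasis, dotProduct_smul, smul_eq_mul] at h1
  exact le_of_mul_le_mul_right h1 hv

/-- Singular values come from `TᵀT` on the large space, the hypothesis from `TTᵀ` on the small one.
An eigenvector `v` of the former is carried to `T v`, an eigenvector of the latter with the same
eigenvalue, and the form is tested there. -/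
theorem le_sigmaMin_sq {n m : ℕ} (hn : 0 < n) (hnm : n ≤ m) {A : Matrix (Fin n) (Fin m) ℝ}
    {c : ℝ} (h : ∀ a : Fin n → ℝ, c * (a ⬝ᵥ a) ≤ a ⬝ᵥ (A * Aᵀ) *ᵥ a) :
    c ≤ sigmaMin A ^ 2 := by
  rcases le_or_gt c 0 with hc | hc
  · exact hc.trans (sq_nonneg _)
  unfold sigmaMin
  rw [min_eq_left hnm]
  set T := Matrix.toEuclideanLin A with hT
  have hadj : LinearMap.adjoint T = Matrix.toEuclideanLin Aᵀ := by
    rw [hT, ← Matrix.toEuclideanLin_conjTranspose_eq_adjoint,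
      Matrix.conjTranspose_eq_transpose_of_trivial]
  have hquad : ∀ u : EuclideanSpace ℝ (Fin n),
      c * inner ℝ u u ≤ inner ℝ u (T (LinearMap.adjoint T u)) := by
    intro u
    have h1 := h (WithLp.ofLp u)
    rw [hadj]
    simp only [EuclideanSpace.inner_eq_star_dotProduct, hT, Matrix.toLpLin_apply, star_trivial,
      Matrix.mulVec_mulVec]
    rw [dotProduct_comm ((A * Aᵀ) *ᵥ _)]
    exact h1
  have hinj : Function.Injective (LinearMap.adjoint T) := by
    rw [← LinearMap.ker_eq_bot, LinearMap.ker_eq_bot']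
    intro u hu
    have h1 := hquad u
    rw [hu, map_zero, inner_zero_right] at h1
    have h2 : (0 : ℝ) ≤ inner ℝ u u := real_inner_self_nonneg
    exact inner_self_eq_zero.1 (le_antisymm (by nlinarith) h2)
  have hrank : Module.finrank ℝ T.range = n := by
    rw [← LinearMap.finrank_range_adjoint, LinearMap.finrank_range_of_inj hinj]
    simp
  -- Full rank makes this singular value nonzero, which is what guarantees `T v ≠ 0` below.
  have hpos : 0 < T.singularValues (n - 1) :=
    T.singularValues_pos_iff_lt_finrank_range.2 (by omega)
  have hev := T.hasEigenvalue_adjoint_comp_self_sq_singularValues (n := n - 1)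
    (by simp; omega)
  obtain ⟨v, hv⟩ := hev.exists_hasEigenvector
  have hvs : LinearMap.adjoint T (T v) = (T.singularValues (n - 1) ^ 2 : ℝ) • v := by
    simpa using hv.apply_eq_smul
  have h1 := hquad (T v)
  rw [hvs, map_smul, inner_smul_right] at h1
  have h3 : (0 : ℝ) < inner ℝ (T v) (T v) := by
    refine lt_of_le_of_ne real_inner_self_nonneg fun h0 => ?_
    have h0' := inner_self_eq_zero.1 h0.symm
    rw [h0', map_zero] at hvs
    exact hv.2 ((smul_eq_zero.1 hvs.symm).resolve_left (by positivity))
  exact le_of_mul_le_mul_right h1 h3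

/-- These are the coefficients of `(1 - s)^(-1/2)`; the numerator is the rising factorial of `1/2`.
-/
theorem Ring.choose_half_nonneg (k : ℕ) : 0 ≤ Ring.choose ((1 / 2 : ℝ) + k - 1) k := by
  rw [Ring.choose_eq_smul]
  rw [smul_eq_mul]
  refine mul_nonneg (by positivity) ?_
  rw [Polynomial.descPochhammer_smeval_eq_ascPochhammer]
  have e : (1 / 2 : ℝ) + k - 1 - k + 1 = 1 / 2 := by ring
  rw [e, Polynomial.ascPochhammer_smeval_eq_eval]
  exact (ascPochhammer_pos k _ (by norm_num)).le

theorem hasSum_one_div_sqrt_one_sub {s : ℝ} (hs : |s| < 1) :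
    HasSum (fun k : ℕ => Ring.choose ((1 / 2 : ℝ) + k - 1) k * s ^ k) (1 / √(1 - s)) := by
  have h := (Real.one_div_one_sub_rpow_hasFPowerSeriesOnBall_zero (1 / 2)).hasSum (y := s) (by
    simp [← ofReal_norm, hs])
  simpa [Real.sqrt_eq_rpow, FormalMultilinearSeries.ofScalars_apply_eq, mul_comm] using h

theorem Matrix.PosSemidef.map_pow {n : ℕ} {G : Matrix (Fin n) (Fin n) ℝ} (hG : G.PosSemidef)
    (k : ℕ) : (G.map (· ^ k)).PosSemidef := by
  induction k with
  | zero =>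
    have : G.map (· ^ 0) = Matrix.vecMulVec (fun _ => 1) (star fun _ => 1) := by
      ext i j; simp [Matrix.vecMulVec]
    rw [this]
    exact Matrix.posSemidef_vecMulVec_self_star _
  | succ k ih =>
    have : G.map (· ^ (k + 1)) = Matrix.hadamard (G.map (· ^ k)) G := by
      ext i j; simp [pow_succ]
    rw [this]
    exact ih.hadamard hG

theorem dotProduct_mulVec_eq_sum {n : ℕ} (A : Matrix (Fin n) (Fin n) ℝ) (a : Fin n → ℝ) :
    a ⬝ᵥ A *ᵥ a = ∑ i, ∑ j, a i * a j * A i j := by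
  simp only [dotProduct, Matrix.mulVec, Finset.mul_sum]
  exact Finset.sum_congr rfl fun i _ => Finset.sum_congr rfl fun j _ => by ring

/-- Schur product of `G - l • 1` with an even Hadamard power of `G`: the power has unit diagonal, so
the subtracted `l • 1` survives unchanged. -/
theorem le_quadForm_odd_pow {n : ℕ} {G : Matrix (Fin n) (Fin n) ℝ} (hG : G.PosSemidef)
    (hdiag : ∀ i, G i i = 1) {l : ℝ} (hl : (G - l • 1).PosSemidef) (a : Fin n → ℝ) (k : ℕ) :
    l * (a ⬝ᵥ a) ≤ ∑ i, ∑ j, a i * a j * (G i j * (G i j ^ 2) ^ k) := by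
  have h := (hl.hadamard (hG.map_pow (2 * k))).dotProduct_mulVec_nonneg a
  rw [star_trivial, dotProduct_mulVec_eq_sum] at h
  have e : ∀ i j, a i * a j * ((G - l • 1).hadamard (G.map (· ^ (2 * k)))) i j =
      a i * a j * (G i j * (G i j ^ 2) ^ k) - l * if i = j then a i * a j else 0 := by
    intro i j
    by_cases hij : i = j
    · subst hij; simp [hdiag]; ring
    · simp [hij, pow_mul]
  simp only [e, Finset.sum_sub_distrib, ← Finset.mul_sum] at h
  simp only [Finset.sum_ite_eq, Finset.mem_univ, if_true] at h
  simpa [dotProduct] using h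

/-- The parameter `ρ` keeps the series away from its boundary: for `0 < ρ < 1` the derivative of `F`
is a convergent series, nonnegative term by term. So `F` increases from `F 0 = 0`, and `F 1 ≥ 0` is
the claim, with `π / 2` being `arcsin 1`. -/
theorem le_quadForm_arcsin {n : ℕ} {G : Matrix (Fin n) (Fin n) ℝ} (hG : G.PosSemidef)
    (hdiag : ∀ i, G i i = 1) (hle : ∀ i j, |G i j| ≤ 1) {l : ℝ} (hl : (G - l • 1).PosSemidef)
    (a : Fin n → ℝ) :
    π / 2 * l * (a ⬝ᵥ a) ≤ ∑ i, ∑ j, a i * a j * arcsin (G i j) := by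
  let F : ℝ → ℝ := fun ρ => ∑ i, ∑ j, a i * a j * arcsin (ρ * G i j) - l * (a ⬝ᵥ a) * arcsin ρ
  have hcont : Continuous F := by fun_prop
  have hlt : ∀ ρ ∈ Set.Ioo (0 : ℝ) 1, ∀ t : ℝ, |t| ≤ 1 → |ρ * t| < 1 := by
    intro ρ hρ t ht
    rw [abs_mul, abs_of_pos hρ.1]
    nlinarith [hρ.1, hρ.2, abs_nonneg t]
  have harc : ∀ ρ ∈ Set.Ioo (0 : ℝ) 1, ∀ t : ℝ, |t| ≤ 1 →
      HasDerivAt (fun ρ => arcsin (ρ * t)) (1 / √(1 - (ρ * t) ^ 2) * t) ρ := by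
    intro ρ hρ t ht
    have hb := abs_lt.1 (hlt ρ hρ t ht)
    have h1 := Real.hasDerivAt_arcsin (x := ρ * t) hb.1.ne' hb.2.ne
    have h2 : HasDerivAt (fun ρ : ℝ => ρ * t) t ρ := by simpa using (hasDerivAt_id ρ).mul_const t
    exact h1.comp ρ h2
  have hF : ∀ ρ ∈ Set.Ioo (0 : ℝ) 1, HasDerivAt F
      (∑ i, ∑ j, a i * a j * (1 / √(1 - (ρ * G i j) ^ 2) * G i j)
        - l * (a ⬝ᵥ a) * (1 / √(1 - ρ ^ 2))) ρ := by
    intro ρ hρ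
    refine HasDerivAt.sub ?_ ?_
    · exact HasDerivAt.fun_sum fun i _ => HasDerivAt.fun_sum fun j _ =>
        (harc ρ hρ _ (hle i j)).const_mul _
    · simpa using (harc ρ hρ 1 (by simp)).const_mul (l * (a ⬝ᵥ a))
  have hser : ∀ ρ ∈ Set.Ioo (0 : ℝ) 1, ∀ t : ℝ, |t| ≤ 1 →
      HasSum (fun k : ℕ => Ring.choose ((1 / 2 : ℝ) + k - 1) k * (ρ ^ 2) ^ k * (t ^ 2) ^ k)
        (1 / √(1 - (ρ * t) ^ 2)) := by
    intro ρ hρ t ht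
    have := hasSum_one_div_sqrt_one_sub (s := (ρ * t) ^ 2) (by
      rw [abs_pow]
      exact pow_lt_one₀ (abs_nonneg _) (hlt ρ hρ t ht) two_ne_zero)
    convert this using 2 with k
    ring
  have hderiv : ∀ ρ ∈ Set.Ioo (0 : ℝ) 1, 0 ≤
      (∑ i, ∑ j, a i * a j * (1 / √(1 - (ρ * G i j) ^ 2) * G i j)
        - l * (a ⬝ᵥ a) * (1 / √(1 - ρ ^ 2))) := by
    intro ρ hρ
    have h1 : HasSum (fun k : ℕ => ∑ i, ∑ j, a i * a j *
        (Ring.choose ((1 / 2 : ℝ) + k - 1) k * (ρ ^ 2) ^ k * (G i j ^ 2) ^ k * G i j))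
        (∑ i, ∑ j, a i * a j * (1 / √(1 - (ρ * G i j) ^ 2) * G i j)) :=
      hasSum_sum fun i _ => hasSum_sum fun j _ =>
        ((hser ρ hρ _ (hle i j)).mul_right _).mul_left _
    have h2 := (hser ρ hρ 1 (by simp)).mul_left (l * (a ⬝ᵥ a))
    rw [mul_one] at h2
    refine sub_nonneg.2 (hasSum_le (fun k => ?_) h2 h1)
    have h3 := mul_le_mul_of_nonneg_left (le_quadForm_odd_pow hG hdiag hl a k)
      (mul_nonneg (Ring.choose_half_nonneg k) (pow_nonneg (sq_nonneg ρ) k))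
    calc _ = Ring.choose ((1 / 2 : ℝ) + k - 1) k * (ρ ^ 2) ^ k * (l * (a ⬝ᵥ a)) := by
          simp; ring
      _ ≤ _ := h3
      _ = _ := by
          simp only [Finset.mul_sum]
          exact Finset.sum_congr rfl fun i _ => Finset.sum_congr rfl fun j _ => by ring
  have hmono : MonotoneOn F (Set.Icc 0 1) := by
    refine monotoneOn_of_deriv_nonneg (convex_Icc 0 1) hcont.continuousOn ?_ ?_
    · rw [interior_Icc]
      exact fun ρ hρ => (hF ρ hρ).differentiableAt.differentiableWithinAt
    · rw [interior_Icc]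
      intro ρ hρ
      rw [(hF ρ hρ).deriv]
      exact hderiv ρ hρ
  have h01 := hmono (Set.left_mem_Icc.2 zero_le_one) (Set.right_mem_Icc.2 zero_le_one) zero_le_one
  simp only [F, zero_mul, arcsin_zero, mul_zero, Finset.sum_const_zero, sub_self, one_mul,
    arcsin_one] at h01
  linarith

end MatrixBounds

/-! ### Gaussian measure of the intersection of two half-spaces -/

section Orthant

theorem gaussianReal_prod_eq_withDensity :
    (gaussianReal 0 1).prod (gaussianReal 0 1) = (volume : Measure (ℝ × ℝ)).withDensity
      fun p => gaussianPDF 0 1 p.1 * gaussianPDF 0 1 p.2 := by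
  rw [gaussianReal_of_var_ne_zero 0 one_ne_zero,
    prod_withDensity (measurable_gaussianPDF 0 1) (measurable_gaussianPDF 0 1)]
  rfl

/-- The planar standard Gaussian measure of a cone is proportional to its angle. -/
theorem gaussianReal_prod_cone {S : Set (ℝ × ℝ)} (hS : MeasurableSet S) {Φ : Set ℝ}
    (hΦ : MeasurableSet Φ) (hΦsub : Φ ⊆ Set.Ioo (-π) π)
    (h : ∀ r φ : ℝ, 0 < r → φ ∈ Set.Ioo (-π) π → ((r * cos φ, r * sin φ) ∈ S ↔ φ ∈ Φ)) :
    (gaussianReal 0 1).prod (gaussianReal 0 1) S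
      = (∫⁻ r in Set.Ioi (0 : ℝ), ENNReal.ofReal (r * ((2 * π)⁻¹ * exp (-r ^ 2 / 2))))
        * volume Φ := by
  rw [gaussianReal_prod_eq_withDensity, withDensity_apply _ hS, ← lintegral_indicator hS,
    ← lintegral_comp_polarCoord_symm]
  have htarget : polarCoord.target = Set.Ioi (0 : ℝ) ×ˢ Set.Ioo (-π) π := rfl
  have hpdf : ∀ r φ : ℝ, gaussianPDF 0 1 (r * cos φ) * gaussianPDF 0 1 (r * sin φ)
      = ENNReal.ofReal ((2 * π)⁻¹ * exp (-r ^ 2 / 2)) := by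
    intro r φ
    rw [gaussianPDF, gaussianPDF, ← ENNReal.ofReal_mul (gaussianPDFReal_nonneg _ _ _)]
    congr 1
    simp only [gaussianPDFReal, NNReal.coe_one, mul_one, sub_zero]
    have h1 : √(2 * π) * √(2 * π) = 2 * π := mul_self_sqrt (by positivity)
    have h2 : -r ^ 2 / 2 = -(r * cos φ) ^ 2 / 2 + -(r * sin φ) ^ 2 / 2 := by
      linear_combination (-r ^ 2 / 2) * -(sin_sq_add_cos_sq φ)
    have h3 : (2 * π)⁻¹ = (√(2 * π))⁻¹ * (√(2 * π))⁻¹ := by rw [← mul_inv, h1]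
    rw [h2, exp_add, h3]
    ring
  have hcongr : ∀ p ∈ polarCoord.target, ENNReal.ofReal p.1 • S.indicator
      (fun p : ℝ × ℝ => gaussianPDF 0 1 p.1 * gaussianPDF 0 1 p.2) (polarCoord.symm p)
      = ENNReal.ofReal (p.1 * ((2 * π)⁻¹ * exp (-p.1 ^ 2 / 2))) * Φ.indicator 1 p.2 := by
    rintro ⟨r, φ⟩ hp
    rw [htarget] at hp
    have hr : 0 < r := hp.1
    have hmem := h r φ hr hp.2
    rw [polarCoord_symm_apply, smul_eq_mul]
    by_cases hφ : φ ∈ Φ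
    · rw [Set.indicator_of_mem (hmem.2 hφ), hpdf, ← ENNReal.ofReal_mul hr.le]
      simp [hφ]
    · rw [Set.indicator_of_notMem (fun hc => hφ (hmem.1 hc))]
      simp [hφ]
  rw [setLIntegral_congr_fun polarCoord.open_target.measurableSet hcongr, htarget,
    Measure.volume_eq_prod, ← Measure.prod_restrict,
    lintegral_prod_mul (f := fun r => ENNReal.ofReal (r * ((2 * π)⁻¹ * exp (-r ^ 2 / 2))))
      (g := Φ.indicator 1) (by fun_prop) ((measurable_one.indicator hΦ).aemeasurable),
    lintegral_indicator_one hΦ, Measure.restrict_apply hΦ, Set.inter_eq_left.2 hΦsub]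

/-- The whole plane is a cone of angle `2π` and mass one, which fixes the radial constant without
integrating. -/
theorem lintegral_rayleigh :
    ∫⁻ r in Set.Ioi (0 : ℝ), ENNReal.ofReal (r * ((2 * π)⁻¹ * exp (-r ^ 2 / 2)))
      = (ENNReal.ofReal (2 * π))⁻¹ := by
  have h := gaussianReal_prod_cone MeasurableSet.univ (measurableSet_Ioo (a := -π) (b := π))
    subset_rfl (by simp)
  rw [measure_univ, Real.volume_Ioo] at h
  rw [sub_neg_eq_add, ← two_mul] at h
  exact ENNReal.eq_inv_of_mul_eq_one_left h.symm

theorem gaussianReal_prod_wedge {θ : ℝ} (h0 : 0 ≤ θ) (hπ : θ < π) :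
    ((gaussianReal 0 1).prod (gaussianReal 0 1)).real
      {p | 0 ≤ p.1 ∧ 0 ≤ cos θ * p.1 + sin θ * p.2} = (π - θ) / (2 * π) := by
  have hpi := pi_pos
  rw [measureReal_def, gaussianReal_prod_cone (Φ := Set.Icc (θ - π / 2) (π / 2)) _
    measurableSet_Icc _ _, lintegral_rayleigh, Real.volume_Icc, ENNReal.toReal_mul,
    ENNReal.toReal_inv, ENNReal.toReal_ofReal (by positivity), ENNReal.toReal_ofReal (by linarith)]
  · field_simp
    ring
  · exact (measurableSet_le measurable_const measurable_fst).inter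
      (measurableSet_le measurable_const
        ((measurable_fst.const_mul _).add (measurable_snd.const_mul _)))
  · intro φ hφ
    constructor <;> linarith [hφ.1, hφ.2]
  · intro r φ hr hφ
    have e : cos θ * (r * cos φ) + sin θ * (r * sin φ) = r * cos (φ - θ) := by
      rw [cos_sub]; ring
    simp only [Set.mem_ofPred_eq, e, mul_nonneg_iff_of_pos_left hr, Set.mem_Icc]
    constructor
    · rintro ⟨h1, h2⟩
      have h3 : φ ≤ π / 2 := by
        by_contra! hc
        exact absurd h1 (not_le.2 (cos_neg_of_pi_div_two_lt_of_lt hc (by linarith [hφ.2])))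
      have h4 : -(π / 2) ≤ φ := by
        by_contra! hc
        rw [← cos_neg] at h1
        exact absurd h1 (not_le.2
          (cos_neg_of_pi_div_two_lt_of_lt (by linarith) (by linarith [hφ.1])))
      refine ⟨?_, h3⟩
      by_contra! hc
      -- `θ < π` and `-π/2 ≤ φ` keep `θ - φ` below `3π/2`, so the cosine is still negative there.
      rw [← cos_neg] at h2
      exact absurd h2 (not_le.2 (cos_neg_of_pi_div_two_lt_of_lt (by linarith) (by linarith)))
    · rintro ⟨h1, h2⟩
      exact ⟨cos_nonneg_of_mem_Icc ⟨by linarith, h2⟩,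
        cos_nonneg_of_mem_Icc ⟨by linarith, by linarith⟩⟩

section

variable {E : Type*} [NormedAddCommGroup E] [InnerProductSpace ℝ E] [FiniteDimensional ℝ E]
  [MeasurableSpace E] [BorelSpace E]

theorem stdGaussian_map_inner {x : E} (hx : ‖x‖ = 1) :
    (stdGaussian E).map (fun w => inner ℝ x w) = gaussianReal 0 1 := by
  have h := IsGaussian.map_eq_gaussianReal (μ := stdGaussian E) (innerSL ℝ x)
  rw [variance_dual_stdGaussian, integral_strongDual_stdGaussian, innerSL_apply_norm, hx] at h
  simpa using h

theorem stdGaussian_map_inner_prod {x z : E} (hx : ‖x‖ = 1) (hz : ‖z‖ = 1)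
    (hxz : inner ℝ x z = 0) :
    (stdGaussian E).map (fun w => (inner ℝ x w, inner ℝ z w))
      = (gaussianReal 0 1).prod (gaussianReal 0 1) := by
  have hG : HasGaussianLaw (fun w : E => (inner ℝ x w, inner ℝ z w)) (stdGaussian E) :=
    IsGaussian.hasGaussianLaw_id.map ((innerSL ℝ x).prod (innerSL ℝ z))
  have hcov : cov[fun w => inner ℝ x w, fun w => inner ℝ z w; stdGaussian E] = 0 := by
    rw [← covarianceBilin_apply_eq_cov IsGaussian.memLp_two_id, covarianceBilin_stdGaussian]
    exact hxz
  have hind := hG.indepFun_of_covariance_eq_zero hcov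
  rw [(indepFun_iff_map_prod_eq_prod_map_map (by fun_prop) (by fun_prop)).1 hind,
    stdGaussian_map_inner hx, stdGaussian_map_inner hz]

/-- Gram–Schmidt gives `y = cos θ • x + sin θ • z` with `x, z` orthonormal, and the two coordinates
of `w` along them form a planar standard Gaussian. For `θ = 0` there is no such `z` to build, so `x
= y` is treated apart. -/
theorem stdGaussian_orthant {x y : E} (hx : ‖x‖ = 1) (hy : ‖y‖ = 1) (hxy : angle x y ≠ π) :
    (stdGaussian E).real {w | 0 ≤ (inner ℝ x w : ℝ) ∧ 0 ≤ (inner ℝ y w : ℝ)}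
      = (π - angle x y) / (2 * π) := by
  set θ := angle x y with hθ
  have h0 : 0 ≤ θ := angle_nonneg x y
  have hπ : θ < π := lt_of_le_of_ne (angle_le_pi x y) hxy
  have hcos : inner ℝ x y = cos θ := by
    rw [hθ, cos_angle, hx, hy]; simp
  have hyy : inner ℝ y y = (1 : ℝ) := by rw [real_inner_self_eq_norm_sq, hy]; norm_num
  have hxx : inner ℝ x x = (1 : ℝ) := by rw [real_inner_self_eq_norm_sq, hx]; norm_num
  rw [← gaussianReal_prod_wedge h0 hπ]
  rcases h0.eq_or_lt with h00 | h00
  · have hxy' : x = y := by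
      rw [← h00, cos_zero] at hcos
      exact (inner_eq_one_iff_of_norm_eq_one hx hy).1 hcos
    subst hxy'
    rw [← h00]
    have e1 : {w : E | 0 ≤ (inner ℝ x w : ℝ) ∧ 0 ≤ (inner ℝ x w : ℝ)}
        = (fun w => (inner ℝ x w : ℝ)) ⁻¹' Set.Ici 0 := by ext; simp
    have e2 : {p : ℝ × ℝ | 0 ≤ p.1 ∧ 0 ≤ cos 0 * p.1 + sin 0 * p.2}
        = Set.Ici 0 ×ˢ Set.univ := by ext; simp
    rw [e1, e2, ← map_measureReal_apply (by fun_prop) measurableSet_Ici, stdGaussian_map_inner hx,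
      measureReal_prod_prod]
    simp
  · have hsin : 0 < sin θ := sin_pos_of_pos_of_lt_pi h00 hπ
    set z : E := (sin θ)⁻¹ • (y - cos θ • x) with hz
    have hxz : inner ℝ x z = (0 : ℝ) := by
      rw [hz, inner_smul_right, inner_sub_right, inner_smul_right, hcos, hxx]
      simp
    have hyz : y = cos θ • x + sin θ • z := by
      rw [hz, smul_smul, mul_inv_cancel₀ hsin.ne']; simp
    have hzz : ‖z‖ = 1 := by
      have h1 : inner ℝ z z = (1 : ℝ) := by
        rw [hyz] at hyy
        simp only [inner_add_left, inner_add_right, inner_smul_left, inner_smul_right, hxz, hxx,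
          real_inner_comm x z, conj_trivial] at hyy
        have := sin_sq_add_cos_sq θ
        have h3 : sin θ ^ 2 * (inner ℝ z z - 1) = 0 := by nlinarith
        have := (mul_eq_zero.1 h3).resolve_left (by positivity)
        linarith
      rw [real_inner_self_eq_norm_sq] at h1
      exact (pow_eq_one_iff_of_nonneg (norm_nonneg _) two_ne_zero).1 h1
    have hms : MeasurableSet {p : ℝ × ℝ | 0 ≤ p.1 ∧ 0 ≤ cos θ * p.1 + sin θ * p.2} :=
      (measurableSet_le measurable_const measurable_fst).inter
        (measurableSet_le measurable_const
        ((measurable_fst.const_mul _).add (measurable_snd.const_mul _)))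
    rw [← stdGaussian_map_inner_prod hx hzz hxz, map_measureReal_apply (by fun_prop) hms]
    congr 1
    ext w
    have : inner ℝ y w = cos θ * inner ℝ x w + sin θ * inner ℝ z w := by
      conv_lhs => rw [hyz]
      simp [inner_add_left, inner_smul_left]
    simp [this]

end

end Orthant

/-! ### Strict Hoeffding bounds for counts -/

section Counting

/-- One-sided Hoeffding bound for the number of samples in `A`; it is strict since the count is
an integer. -/
theorem measureReal_pi_count_gt_lt {E : Type*} [MeasurableSpace E] (μ : Measure E)
    [IsProbabilityMeasure μ] {A : Set E} (hA : MeasurableSet A) {m : ℕ} (hm : 0 < m) {t : ℝ}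
    (ht : 0 ≤ t) :
    (Measure.pi fun _ : Fin m => μ).real {w | m * μ.real A + t < ∑ r, A.indicator 1 (w r)}
      < exp (-(2 * t ^ 2 / m)) := by
  classical
  set p := μ.real A with hp
  set P := Measure.pi fun _ : Fin m => μ with hP
  have hmeas : Measurable (A.indicator (1 : E → ℝ)) := measurable_one.indicator hA
  have hint : ∀ r, ∫ w, A.indicator (1 : E → ℝ) (w r) ∂P = p := by
    intro r
    rw [hP, integral_comp_eval (i := r) hmeas.aestronglyMeasurable, integral_indicator_one hA]
  have hsub : ∀ r ∈ (Finset.univ : Finset (Fin m)), HasSubgaussianMGF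
      (fun w : Fin m → E => A.indicator (1 : E → ℝ) (w r) - p) ((‖(1 : ℝ) - 0‖₊ / 2) ^ 2) P := by
    intro r _
    have := hasSubgaussianMGF_of_mem_Icc (μ := P) (a := 0) (b := 1)
      (X := fun w : Fin m → E => A.indicator (1 : E → ℝ) (w r))
      (hmeas.comp (measurable_pi_apply r)).aemeasurable
      (ae_of_all _ fun w => by
        by_cases h : w r ∈ A <;> simp [h])
    rwa [hint] at this
  have hind : iIndepFun (fun r (w : Fin m → E) => A.indicator (1 : E → ℝ) (w r) - p) P :=
    iIndepFun_pi (X := fun _ v => A.indicator (1 : E → ℝ) v - p)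
      fun _ => (hmeas.sub_const p).aemeasurable
  have hm' : (0 : ℝ) < m := by exact_mod_cast hm
  have hp0 : 0 ≤ m * p + t := by positivity
  -- The least integer above `m * p + t`: an integer count exceeding the threshold is already at
  -- least `k`, so Hoeffding applies with the larger deviation `k - m * p > t`.
  set k : ℕ := ⌊m * p + t⌋₊ + 1 with hk
  have hkt : t < k - m * p := by
    have := Nat.lt_floor_add_one (m * p + t)
    rw [hk]; push_cast; linarith
  have hho := HasSubgaussianMGF.measure_sum_ge_le_of_iIndepFun hind hsub (ht.trans hkt.le)
  refine (measureReal_mono ?_).trans_lt (hho.trans_lt ?_)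
  · intro w hw
    have hcount : ∑ r, A.indicator (1 : E → ℝ) (w r)
        = ((Finset.univ.filter fun r => w r ∈ A).card : ℝ) := by
      simp [Set.indicator_apply]
    simp only [Set.mem_ofPred_eq] at hw ⊢
    rw [hcount] at hw
    have h2 : k ≤ (Finset.univ.filter fun r => w r ∈ A).card :=
      Nat.succ_le_of_lt ((Nat.floor_lt hp0).2 hw)
    have h3 : (k : ℝ) ≤ _ := Nat.cast_le (α := ℝ).2 h2
    rw [Finset.sum_sub_distrib, hcount]
    simp
    linarith
  · rw [exp_lt_exp]
    have h4 : t ^ 2 < (k - m * p) ^ 2 := by gcongr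
    have e : ((∑ _r : Fin m, (‖(1 : ℝ) - 0‖₊ / 2) ^ 2 : NNReal) : ℝ) = m / 4 := by
      simp; ring
    rw [e, neg_div, neg_lt_neg_iff]
    have : 2 * (m / 4 : ℝ) = m / 2 := by ring
    rw [this, div_div_eq_mul_div]
    gcongr ?_ / _
    linarith

/-- The lower-tail counterpart of `measureReal_pi_count_gt_lt`. -/
theorem measureReal_pi_count_lt_lt {E : Type*} [MeasurableSpace E] (μ : Measure E)
    [IsProbabilityMeasure μ] {A : Set E} (hA : MeasurableSet A) {m : ℕ} (hm : 0 < m) {t : ℝ}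
    (ht : 0 ≤ t) :
    (Measure.pi fun _ : Fin m => μ).real {w | ∑ r, A.indicator 1 (w r) < m * μ.real A - t}
      < exp (-(2 * t ^ 2 / m)) := by
  -- Few samples in `A` means many in its complement.
  have h := measureReal_pi_count_gt_lt μ hA.compl hm ht
  convert h using 4 with w
  rw [probReal_compl_eq_one_sub hA]
  have : ∑ r, Aᶜ.indicator (1 : E → ℝ) (w r) = m - ∑ r, A.indicator (1 : E → ℝ) (w r) := by
    simp [Set.indicator_compl]
  rw [this]
  constructor <;> intro h <;> linarith

end Counting

/-! ### Activation matrix, `℧` and the angle `θ*` -/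

section Activation

variable {d n m : ℕ}

/-- The closed half-space of weights that activate the input `x`. -/
def activeSet (x : EuclideanSpace ℝ (Fin d)) : Set (EuclideanSpace ℝ (Fin d)) :=
  {w | 0 ≤ (inner ℝ x w : ℝ)}

theorem measurableSet_activeSet (x : EuclideanSpace ℝ (Fin d)) : MeasurableSet (activeSet x) :=
  measurableSet_le measurable_const (by fun_prop)

theorem reluDeriv_inner (x w : EuclideanSpace ℝ (Fin d)) :
    reluDeriv (inner ℝ x w) = (activeSet x).indicator 1 w := by
  simp [reluDeriv, activeSet, Set.indicator_apply]

theorem activationMatrix_apply (x : Fin n → EuclideanSpace ℝ (Fin d))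
    (w : Fin m → EuclideanSpace ℝ (Fin d)) (i : Fin n) (r : Fin m) :
    activationMatrix x w i r = (activeSet (x i)).indicator 1 (w r) := by
  rw [← reluDeriv_inner]
  simp [activationMatrix, Matrix.mul_apply, dataMatrix, weightMatrix, PiLp.inner_apply, mul_comm]

theorem activationMatrix_mul_apply (x : Fin n → EuclideanSpace ℝ (Fin d))
    (w : Fin m → EuclideanSpace ℝ (Fin d)) (i j : Fin n) (r : Fin m) :
    activationMatrix x w i r * activationMatrix x w j r
      = (activeSet (x i) ∩ activeSet (x j)).indicator 1 (w r) := by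
  rw [activationMatrix_apply, activationMatrix_apply, Set.inter_indicator_one]
  rfl

theorem activationMatrix_mul_transpose_apply (x : Fin n → EuclideanSpace ℝ (Fin d))
    (w : Fin m → EuclideanSpace ℝ (Fin d)) (i j : Fin n) :
    (activationMatrix x w * (activationMatrix x w).transpose) i j
      = ∑ r, (activeSet (x i) ∩ activeSet (x j)).indicator 1 (w r) := by
  simp only [Matrix.mul_apply, Matrix.transpose_apply, activationMatrix_mul_apply]

theorem norm_row_activationMatrix_sq (x : Fin n → EuclideanSpace ℝ (Fin d))
    (w : Fin m → EuclideanSpace ℝ (Fin d)) (i : Fin n) :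
    ‖row (activationMatrix x w) i‖ ^ 2 = ∑ r, (activeSet (x i)).indicator 1 (w r) := by
  rw [EuclideanSpace.real_norm_sq_eq]
  refine Finset.sum_congr rfl fun r _ => ?_
  simpa [row, sq] using activationMatrix_mul_apply x w i i r

theorem inner_row_activationMatrix_le (x : Fin n → EuclideanSpace ℝ (Fin d))
    (w : Fin m → EuclideanSpace ℝ (Fin d)) (i j : Fin n) :
    inner ℝ (row (activationMatrix x w) i) (row (activationMatrix x w) j)
      ≤ ‖row (activationMatrix x w) i‖ ^ 2 := by
  rw [norm_row_activationMatrix_sq, PiLp.inner_apply]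
  refine Finset.sum_le_sum fun r _ => ?_
  have h := activationMatrix_mul_apply x w i j r
  have e : inner ℝ (row (activationMatrix x w) i r) (row (activationMatrix x w) j r)
      = activationMatrix x w i r * activationMatrix x w j r := by
    simp [row, mul_comm]
  rw [e, h]
  exact Set.indicator_le_indicator_of_subset Set.inter_subset_left (fun _ => zero_le_one) _

theorem frobNorm_sq (A : Matrix (Fin n) (Fin m) ℝ) :
    frobNorm A ^ 2 = ∑ i, ‖row A i‖ ^ 2 := by
  simp only [frobNorm, Matrix.frobenius_norm_def, EuclideanSpace.real_norm_sq_eq, row]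
  rw [← Real.sqrt_eq_rpow, Real.sq_sqrt (by positivity)]
  simp

instance isProbabilityMeasure_initMeasure : IsProbabilityMeasure (initMeasure d m) := by
  unfold initMeasure; infer_instance

theorem stdGaussian_real_activeSet {x : EuclideanSpace ℝ (Fin d)} (hx : ‖x‖ = 1) :
    (stdGaussian (EuclideanSpace ℝ (Fin d))).real (activeSet x) = 1 / 2 := by
  have h := stdGaussian_orthant hx hx
  have hx0 : x ≠ 0 := by rintro rfl; simp at hx
  rw [angle_self hx0] at h
  have := h pi_pos.ne
  simp only [and_self] at this
  rw [activeSet, this]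
  field_simp
  ring

theorem mho_eq_real (x : Fin n → EuclideanSpace ℝ (Fin d)) (i j : Fin n) :
    mho x i j = (stdGaussian (EuclideanSpace ℝ (Fin d))).real
      (activeSet (x i) ∩ activeSet (x j)) := by
  rw [← integral_indicator_one ((measurableSet_activeSet _).inter (measurableSet_activeSet _))]
  simp only [mho, Matrix.of_apply, reluDeriv_inner, Set.inter_indicator_one]
  rfl

theorem mho_isHermitian (x : Fin n → EuclideanSpace ℝ (Fin d)) : (mho x).IsHermitian := by
  ext i j
  simp [mho, mul_comm]

theorem gram_apply (x : Fin n → EuclideanSpace ℝ (Fin d)) (i j : Fin n) :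
    ((dataMatrix x).transpose * dataMatrix x) i j = inner ℝ (x i) (x j) := by
  simp [Matrix.mul_apply, dataMatrix, PiLp.inner_apply, mul_comm]

/-- Since `π - θ = π/2 + arcsin(cos θ)`, `℧` is a quarter of the all-ones matrix plus `arcsin(G) /
(2π)`. The first summand contributes `(∑ aᵢ)² / 4 ≥ 0` and is dropped; the second gives `(2π)⁻¹ ·
π/2 = 1/4`. -/
theorem lambdaMin_gram_le (x : Fin n → EuclideanSpace ℝ (Fin d)) (hn : 0 < n)
    (hx : ∀ i, ‖x i‖ = 1) (h : ∀ i j, mho x i j = (π - angle (x i) (x j)) / (2 * π)) :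
    lambdaMin ((dataMatrix x).transpose * dataMatrix x) / 4 ≤ lambdaMin (mho x) := by
  set G := (dataMatrix x).transpose * dataMatrix x with hGdef
  have hG : G.PosSemidef := by
    have := Matrix.posSemidef_conjTranspose_mul_self (dataMatrix x)
    rwa [Matrix.conjTranspose_eq_transpose_of_trivial] at this
  have hdiag : ∀ i, G i i = 1 := fun i => by
    rw [hGdef, gram_apply, real_inner_self_eq_norm_sq, hx]; norm_num
  have hle : ∀ i j, |G i j| ≤ 1 := fun i j => by
    rw [hGdef, gram_apply]
    simpa [hx] using abs_real_inner_le_norm (x i) (x j)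
  refine le_lambdaMin hn (mho_isHermitian x) fun a => ?_
  have h1 := le_quadForm_arcsin hG hdiag hle (posSemidef_sub_lambdaMin hG.isHermitian) a
  have h2 : ∀ i j, mho x i j = 1 / 4 + (2 * π)⁻¹ * arcsin (G i j) := fun i j => by
    have e : G i j = cos (angle (x i) (x j)) := by
      rw [hGdef, gram_apply, cos_angle, hx, hx]; simp
    rw [h, e, ← sin_pi_div_two_sub, arcsin_sin (by linarith [angle_le_pi (x i) (x j)])
      (by linarith [angle_nonneg (x i) (x j)])]
    field_simp
    ring
  have h3 : ∑ i, ∑ j, a i * a j * mho x i j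
      = (∑ i, a i) ^ 2 / 4 + (2 * π)⁻¹ * ∑ i, ∑ j, a i * a j * arcsin (G i j) := by
    rw [sq, Finset.sum_mul_sum]
    simp only [Finset.sum_div, Finset.mul_sum, ← Finset.sum_add_distrib]
    exact Finset.sum_congr rfl fun i _ => Finset.sum_congr rfl fun j _ => by rw [h2]; ring
  rw [dotProduct_mulVec_eq_sum, h3]
  have h4 := mul_le_mul_of_nonneg_left h1 (show (0 : ℝ) ≤ (2 * π)⁻¹ by positivity)
  have h5 : (2 * π)⁻¹ * (π / 2 * lambdaMin G * (a ⬝ᵥ a)) = lambdaMin G / 4 * (a ⬝ᵥ a) := by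
    field_simp
    ring
  nlinarith [sq_nonneg (∑ i, a i)]

theorem lambdaMin_mho_le (x : Fin n → EuclideanSpace ℝ (Fin d)) (hn : 0 < n)
    (hx : ∀ i, ‖x i‖ = 1) : lambdaMin (mho x) ≤ 1 / 2 := by
  have h := lambdaMin_mul_le (mho_isHermitian x) (Pi.single ⟨0, hn⟩ 1)
  simp only [Matrix.mulVec_single_one, single_one_dotProduct, Pi.single_eq_same, mul_one,
    Matrix.col_apply] at h
  rwa [mho_eq_real, Set.inter_self, stdGaussian_real_activeSet (hx _)] at h

theorem thetaStar_nonneg (x : Fin n → EuclideanSpace ℝ (Fin d)) : 0 ≤ thetaStar x :=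
  le_min (Real.iInf_nonneg fun _ => angle_nonneg _ _)
    (sub_nonneg.2 (Real.iSup_le (fun _ => angle_le_pi _ _) pi_pos.le))

theorem thetaStar_le (x : Fin n → EuclideanSpace ℝ (Fin d)) (hn : 2 ≤ n) :
    thetaStar x ≤ π / 2 := by
  let p : {p : Fin n × Fin n // p.1 ≠ p.2} :=
    ⟨(⟨0, by omega⟩, ⟨1, by omega⟩), by simp [Fin.ext_iff]⟩
  have h1 : thetaMin x ≤ angle (x p.1.1) (x p.1.2) :=
    ciInf_le (Set.finite_range _).bddBelow p
  have h2 : angle (x p.1.1) (x p.1.2) ≤ thetaMax x :=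
    le_ciSup (f := fun p : {p : Fin n × Fin n // p.1 ≠ p.2} => angle (x p.1.1) (x p.1.2))
      (Set.finite_range _).bddAbove p
  have h3 : thetaStar x ≤ thetaMin x := min_le_left _ _
  have h4 : thetaStar x ≤ π - thetaMax x := min_le_right _ _
  linarith

/-- The constant `1/2` is what Hoeffding's `m / 2` requires; `θ* ≤ π/2` leaves room to spare. -/
theorem half_le_thetaStar_coeff (x : Fin n → EuclideanSpace ℝ (Fin d)) (hn : 2 ≤ n) :
    1 / 2 ≤ 2 - thetaStar x * (thetaStar x + 3 * π) / (2 * π ^ 2) := by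
  have h0 := thetaStar_nonneg x
  have h1 := thetaStar_le x hn
  have hpi := pi_pos
  have h2 : thetaStar x * (thetaStar x + 3 * π) / (2 * π ^ 2) ≤ 3 / 2 := by
    rw [div_le_iff₀ (by positivity)]
    nlinarith
  linarith

/-- An entrywise error `t` changes the form by at most `t (∑ |aᵢ|)²`, and Cauchy–Schwarz turns this
into `n t ‖a‖²`. -/
theorem le_sigmaMin_sq_of_gram_close {A : Matrix (Fin n) (Fin m) ℝ}
    {M : Matrix (Fin n) (Fin n) ℝ} (hM : M.IsHermitian) (hn : 0 < n) (hnm : n ≤ m) {s t : ℝ}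
    (hs : 0 ≤ s) (ht : 0 ≤ t)
    (h : ∀ i j, |(A * A.transpose) i j - s * M i j| ≤ t) :
    lambdaMin M * s - n * t ≤ sigmaMin A ^ 2 := by
  refine le_sigmaMin_sq hn hnm fun a => ?_
  have h1 := mul_le_mul_of_nonneg_left (lambdaMin_mul_le hM a) hs
  rw [dotProduct_mulVec_eq_sum] at h1 ⊢
  have h2 : ∑ i, ∑ j, (s * (a i * a j * M i j) - t * (|a i| * |a j|))
      ≤ ∑ i, ∑ j, a i * a j * (A * A.transpose) i j := by
    refine Finset.sum_le_sum fun i _ => Finset.sum_le_sum fun j _ => ?_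
    have h3 := neg_abs_le (a i * a j * ((A * A.transpose) i j - s * M i j))
    rw [abs_mul, abs_mul] at h3
    have h4 := mul_le_mul_of_nonneg_left (h i j) (mul_nonneg (abs_nonneg (a i)) (abs_nonneg (a j)))
    linarith
  have h3 : ∑ i, ∑ j, |a i| * |a j| ≤ n * (a ⬝ᵥ a) := by
    rw [← Finset.sum_mul_sum, ← sq]
    refine (sq_sum_le_card_mul_sum_sq (s := Finset.univ) (f := fun i => |a i|)).trans_eq ?_
    simp [dotProduct, sq]
  simp only [Finset.sum_sub_distrib, ← Finset.mul_sum] at h2 h3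
  nlinarith [mul_le_mul_of_nonneg_left h3 ht]

end Activation

/-! ### Tail bounds under the random initialization -/

section Concentration

variable {d n m : ℕ}

theorem exp_neg_two_mul_sqrt_sq {m : ℕ} (hm : 0 < m) {L : ℝ} (hL : 0 ≤ L) :
    exp (-(2 * √((m : ℝ) / 2 * L) ^ 2 / m)) = exp (-L) := by
  have : (0 : ℝ) < m := by exact_mod_cast hm
  rw [Real.sq_sqrt (by positivity)]
  congr 2
  field_simp

theorem initMeasure_count_gt_lt {A : Set (EuclideanSpace ℝ (Fin d))} (hA : MeasurableSet A)
    {L : ℝ} (hL : 0 ≤ L) :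
    (initMeasure d m).real {w | m * (stdGaussian _).real A + √((m : ℝ) / 2 * L)
      < ∑ r, A.indicator 1 (w r)} < exp (-L) := by
  -- With no samples the event reads `0 < 0` and is empty.
  rcases Nat.eq_zero_or_pos m with rfl | hm
  · simpa using exp_pos (-L)
  · rw [← exp_neg_two_mul_sqrt_sq hm hL]
    exact measureReal_pi_count_gt_lt _ hA hm (sqrt_nonneg _)

theorem initMeasure_count_lt_lt {A : Set (EuclideanSpace ℝ (Fin d))} (hA : MeasurableSet A)
    {L : ℝ} (hL : 0 ≤ L) :
    (initMeasure d m).real {w | ∑ r, A.indicator 1 (w r)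
      < m * (stdGaussian _).real A - √((m : ℝ) / 2 * L)} < exp (-L) := by
  rcases Nat.eq_zero_or_pos m with rfl | hm
  · simpa using exp_pos (-L)
  · rw [← exp_neg_two_mul_sqrt_sq hm hL]
    exact measureReal_pi_count_lt_lt _ hA hm (sqrt_nonneg _)

theorem one_sub_lt_measureReal {Ω : Type*} [MeasurableSpace Ω] {P : Measure Ω}
    [IsProbabilityMeasure P] {S B : Set Ω} {ε : ℝ} (h : ∀ ω, ω ∉ B → ω ∈ S) (hB : P.real B < ε) :
    1 - ε < P.real S := by
  have h1 : P.real Set.univ ≤ P.real S + P.real B :=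
    (measureReal_mono fun ω _ => or_iff_not_imp_right.2 (h ω)).trans (measureReal_union_le S B)
  rw [probReal_univ] at h1
  linarith

theorem measureReal_iUnion_lt {Ω ι : Type*} [MeasurableSpace Ω] [Fintype ι] [Nonempty ι]
    {P : Measure Ω} [IsProbabilityMeasure P] {B : ι → Set Ω} {ε : ℝ} (h : ∀ i, P.real (B i) < ε) :
    P.real (⋃ i, B i) < Fintype.card ι * ε := by
  refine (measureReal_iUnion_fintype_le B).trans_lt ?_
  refine (Finset.sum_lt_sum_of_nonempty Finset.univ_nonempty fun i _ => h i).trans_eq ?_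
  simp

theorem one_sub_lt_measureReal_gram_close (x : Fin n → EuclideanSpace ℝ (Fin d)) (hn : 0 < n)
    {L : ℝ} (hL : 0 ≤ L) :
    1 - n * n * (2 * exp (-L)) < (initMeasure d m).real
      {w | ∀ i j, |(activationMatrix x w * (activationMatrix x w).transpose) i j - m * mho x i j|
        ≤ √((m : ℝ) / 2 * L)} := by
  have : Nonempty (Fin n) := ⟨⟨0, hn⟩⟩
  let A : Fin n × Fin n → Set (EuclideanSpace ℝ (Fin d)) :=
    fun p => activeSet (x p.1) ∩ activeSet (x p.2)
  have hA : ∀ p, MeasurableSet (A p) :=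
    fun p => (measurableSet_activeSet _).inter (measurableSet_activeSet _)
  have h := measureReal_iUnion_lt (P := initMeasure d m) (ε := 2 * exp (-L))
    (B := fun p => {w | m * (stdGaussian _).real (A p) + √((m : ℝ) / 2 * L)
      < ∑ r, (A p).indicator 1 (w r)} ∪ {w | ∑ r, (A p).indicator 1 (w r)
      < m * (stdGaussian _).real (A p) - √((m : ℝ) / 2 * L)}) fun p => by
    have h1 := initMeasure_count_gt_lt (m := m) (hA p) hL
    have h2 := initMeasure_count_lt_lt (m := m) (hA p) hL
    exact (measureReal_union_le _ _).trans_lt (by linarith)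
  simp only [Fintype.card_prod, Fintype.card_fin, Nat.cast_mul] at h
  refine one_sub_lt_measureReal (fun w hw i j => ?_) h
  simp only [Set.mem_iUnion, not_exists, Set.mem_union, not_or, Set.mem_ofPred_eq, not_lt] at hw
  obtain ⟨h1, h2⟩ := hw (i, j)
  rw [activationMatrix_mul_transpose_apply, mho_eq_real, abs_le]
  constructor <;> linarith

end Concentration

/-! ### Assembly of the estimates -/

theorem mainTheorem3 :
    ∃ C : ℝ, 0 < C ∧
      ∀ (d n m : ℕ) (x : Fin n → EuclideanSpace ℝ (Fin d)),
        1 ≤ n →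
        (∀ i, ‖x i‖ = 1) →
        (∃ θ₀ : ℝ, 0 < θ₀ ∧
          ∀ i j, i ≠ j → θ₀ ≤ min (angle (x i) (x j)) (π - angle (x i) (x j))) →
        -- the angle form of `℧` and the bounds on its smallest eigenvalue `λ*`
        (∀ i j, mho x i j = (π - angle (x i) (x j)) / (2 * π)) ∧
        lambdaMin ((dataMatrix x).transpose * dataMatrix x) / 4 ≤ lambdaMin (mho x) ∧
        lambdaMin (mho x) ≤ 1 / 2 ∧
        ∀ δ : ℝ, 0 < δ → δ < 1 →
          -- squared norm of each row
          (∀ i : Fin n, 1 - δ < (initMeasure d m).real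
            {w | ‖row (activationMatrix x w) i‖ ^ 2 ≤
              (m : ℝ) / 2 + √((m : ℝ) / 2 * Real.log (1 / δ))}) ∧
          (∀ i : Fin n, 1 - δ < (initMeasure d m).real
            {w | (m : ℝ) / 2 - √((m : ℝ) / 2 * Real.log (1 / δ)) ≤
              ‖row (activationMatrix x w) i‖ ^ 2}) ∧
          -- squared Frobenius norm
          (1 - (n : ℝ) * δ < (initMeasure d m).real
            {w | frobNorm (activationMatrix x w) ^ 2 ≤
              (m : ℝ) * n / 2 + n * √((m : ℝ) / 2 * Real.log (1 / δ))}) ∧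
          (1 - (n : ℝ) * δ < (initMeasure d m).real
            {w | (m : ℝ) * n / 2 - n * √((m : ℝ) / 2 * Real.log (1 / δ)) ≤
              frobNorm (activationMatrix x w) ^ 2}) ∧
          -- inner product of each pair of different rows
          (∀ i j : Fin n, i ≠ j → 1 - 2 * δ < (initMeasure d m).real
            {w | inner ℝ (row (activationMatrix x w) i) (row (activationMatrix x w) j) ≤
              (m : ℝ) / 2 + √((m : ℝ) / 2 * Real.log (1 / δ))}) ∧
          -- smallest singular value in the over-parameterized setting
          (2 ≤ n → n ≤ m →
            1 - ((m : ℝ) * n - m + n + 2) * δ < (initMeasure d m).real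
              {w | lambdaMin (mho x) * m
                  - n * √((2 - thetaStar x * (thetaStar x + 3 * π) / (2 * π ^ 2)) * m
                      * Real.log (2 * n / δ))
                  - C * (√(m * Real.log (1 / δ)) + n * Real.log (2 * n / δ) / √δ)
                < sigmaMin (activationMatrix x w) ^ 2}) := by
  -- Any positive constant would do: the `C` term only makes the last inequality strict.
  refine ⟨1, one_pos, fun d n m x hn hx ⟨θ₀, hθ₀, hθ⟩ => ?_⟩
  have hangle : ∀ i j, angle (x i) (x j) ≠ π := by
    intro i j h
    by_cases hij : i = j
    · subst hij
      rw [angle_self (by intro h0; simpa [h0] using hx i)] at h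
      exact pi_pos.ne h
    · have := (hθ i j hij).trans (min_le_right _ _)
      linarith
  have hmho : ∀ i j, mho x i j = (π - angle (x i) (x j)) / (2 * π) := fun i j => by
    rw [mho_eq_real, ← stdGaussian_orthant (hx i) (hx j) (hangle i j)]
    rfl
  refine ⟨hmho, lambdaMin_gram_le x hn hx hmho, lambdaMin_mho_le x hn hx, fun δ hδ hδ1 => ?_⟩
  have hL : 0 ≤ Real.log (1 / δ) := Real.log_nonneg (one_le_one_div hδ hδ1.le)
  have hexp : exp (-Real.log (1 / δ)) = δ := by
    rw [one_div, Real.log_inv, neg_neg, exp_log hδ]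
  have hne : Nonempty (Fin n) := ⟨⟨0, hn⟩⟩
  have hup : ∀ i : Fin n, (initMeasure d m).real {w | (m : ℝ) / 2 +
      √((m : ℝ) / 2 * Real.log (1 / δ)) < ‖row (activationMatrix x w) i‖ ^ 2} < δ := fun i => by
    have h := initMeasure_count_gt_lt (m := m) (measurableSet_activeSet (x i)) hL
    rw [stdGaussian_real_activeSet (hx i), hexp, mul_one_div] at h
    simpa only [norm_row_activationMatrix_sq] using h
  have hlow : ∀ i : Fin n, (initMeasure d m).real {w | ‖row (activationMatrix x w) i‖ ^ 2 <
      (m : ℝ) / 2 - √((m : ℝ) / 2 * Real.log (1 / δ))} < δ := fun i => by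
    have h := initMeasure_count_lt_lt (m := m) (measurableSet_activeSet (x i)) hL
    rw [stdGaussian_real_activeSet (hx i), hexp, mul_one_div] at h
    simpa only [norm_row_activationMatrix_sq] using h
  refine ⟨
    fun i => one_sub_lt_measureReal (fun w hw => by
      simpa only [Set.mem_ofPred_eq, not_lt] using hw) (hup i),
    fun i => one_sub_lt_measureReal (fun w hw => by
      simpa only [Set.mem_ofPred_eq, not_lt] using hw) (hlow i), ?_, ?_, ?_, ?_⟩
  · have h := measureReal_iUnion_lt hup
    rw [Fintype.card_fin] at h
    refine one_sub_lt_measureReal (fun w hw => ?_) h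
    simp only [Set.mem_iUnion, Set.mem_ofPred_eq, not_exists, not_lt] at hw ⊢
    rw [frobNorm_sq]
    refine (Finset.sum_le_sum fun i _ => hw i).trans_eq ?_
    simp
    ring
  · have h := measureReal_iUnion_lt hlow
    rw [Fintype.card_fin] at h
    refine one_sub_lt_measureReal (fun w hw => ?_) h
    simp only [Set.mem_iUnion, Set.mem_ofPred_eq, not_exists, not_lt] at hw ⊢
    rw [frobNorm_sq]
    refine Eq.trans_le ?_ (Finset.sum_le_sum fun i _ => hw i)
    simp
    ring
  · intro i j _
    exact one_sub_lt_measureReal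
      (fun w hw => (inner_row_activationMatrix_le x w i j).trans (not_lt.1 hw))
      ((hup i).trans (by linarith))
  · intro hn2 hnm
    have hn0 : (0 : ℝ) < n := by exact_mod_cast hn
    have hn2' : (2 : ℝ) ≤ n := by exact_mod_cast hn2
    have hnm' : (n : ℝ) ≤ m := by exact_mod_cast hnm
    have harg : 1 < 2 * n / δ := by
      rw [lt_div_iff₀ hδ]; linarith
    have hL' : 0 < Real.log (2 * n / δ) := Real.log_pos harg
    -- Two tails for each of the `n²` ordered pairs then cost `n² · 2 · δ / (2n) = n δ` in total.
    have hexp' : exp (-Real.log (2 * n / δ)) = δ / (2 * n) := by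
      rw [← Real.log_inv, exp_log (by positivity), inv_div]
    have h := one_sub_lt_measureReal_gram_close (m := m) x hn hL'.le
    have hprob : (n : ℝ) * n * (2 * (δ / (2 * n))) = n * δ := by
      field_simp
    rw [hexp', hprob] at h
    -- The allowed failure exceeds `n δ` by `(m (n - 1) + 2) δ ≥ 0`.
    have hbudget : (n : ℝ) * δ ≤ ((m : ℝ) * n - m + n + 2) * δ :=
      mul_le_mul_of_nonneg_right (by nlinarith) hδ.le
    refine (sub_le_sub_left hbudget 1).trans_lt (h.trans_le (measureReal_mono fun w hw => ?_))
    have hσ := le_sigmaMin_sq_of_gram_close (mho_isHermitian x) hn hnm (Nat.cast_nonneg m)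
      (sqrt_nonneg _) hw
    have hsqrt : √((m : ℝ) / 2 * Real.log (2 * n / δ)) ≤
        √((2 - thetaStar x * (thetaStar x + 3 * π) / (2 * π ^ 2)) * m * Real.log (2 * n / δ)) := by
      refine Real.sqrt_le_sqrt (mul_le_mul_of_nonneg_right ?_ hL'.le)
      have := mul_le_mul_of_nonneg_right (half_le_thetaStar_coeff x hn2)
        (Nat.cast_nonneg (α := ℝ) m)
      linarith
    have hextra : 0 < √(m * Real.log (1 / δ)) + n * Real.log (2 * n / δ) / √δ := by positivity
    have := mul_le_mul_of_nonneg_left hsqrt hn0.le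
    simp only [Set.mem_ofPred_eq]
    linarith
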